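/- For a set $\Gamma$ and a natural number $n$, let $\sigma_n(\Gamma)=\{x\in\{0,1\}^\Gamma : |\{\gamma\in\Gamma : x_\gamma\neq 0\}|\le n\}$, a compact space with the topology inherited from the product topology of $\{0,1\}^\Gamma$; for a compact space $K$, let $C(K)$ be the Banach space of continuous real-valued functions on $K$ with the supremum norm. Let $\Gamma$ be an infinite set and let $(k_n)_{n<\omega}$ be any sequence of positive integers. Then the Banach spaces $C\left(\prod_{n<\omega}\sigma_{k_n}(\Gamma)\right)$ and $C(\sigma_1(\Gamma)^\omega)$ are isomorphic, that is, there is a bounded linear bijection with bounded inverse between them. -/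

import Mathlib

/-- The support of a point `x` of the Cantor cube `{0,1}^Γ`, with `{0,1}` modelled by the
discrete space `Bool`: the set of the coordinates at which `x` is not `0`. -/
def cubeSupport {Γ : Type*} (x : Γ → Bool) : Set Γ := {γ | x γ ≠ false}

/-- `σ_n(Γ)`: the points of `{0,1}^Γ` whose support has at most `n` elements. As a type it
carries the subspace topology of the product topology on `{0,1}^Γ`. -/
def sigmaSpace (n : ℕ) (Γ : Type*) : Set (Γ → Bool) := {x | (cubeSupport x).encard ≤ n}

/-- `σ_n(Γ)` is closed in `{0,1}^Γ`. -/
theorem isClosed_sigmaSpace (n : ℕ) (Γ : Type*) : IsClosed (sigmaSpace n Γ) := by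
  have h : sigmaSpace n Γ =
      ⋂ F : {F : Finset Γ // F.card = n + 1}, {x | ∀ γ ∈ F.1, x γ = true}ᶜ := by
    ext x
    simp only [Set.mem_iInter, Set.mem_compl_iff, Set.mem_ofPred_eq, Subtype.forall]
    constructor
    · intro hx F hF hall
      have hsub : (F : Set Γ) ⊆ cubeSupport x := by
        intro γ hγ
        simp [cubeSupport, hall γ hγ]
      have h1 : (F : Set Γ).encard ≤ (n : ℕ∞) := (Set.encard_le_encard hsub).trans hx
      rw [Set.encard_coe_eq_coe_finsetCard, hF] at h1
      have h2 : n + 1 ≤ n := by exact_mod_cast h1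
      omega
    · intro hall
      by_contra hx
      have hlt : (n : ℕ∞) < (cubeSupport x).encard := not_le.mp hx
      have hle : ((n + 1 : ℕ) : ℕ∞) ≤ (cubeSupport x).encard := by
        push_cast
        exact Order.add_one_le_of_lt hlt
      obtain ⟨t, ht, hcard⟩ := Set.exists_subset_encard_eq hle
      have hfin : t.Finite := Set.finite_of_encard_eq_coe hcard
      refine hall hfin.toFinset ?_ ?_
      · have h3 := hfin.encard_eq_coe_toFinset_card
        rw [hcard] at h3
        exact_mod_cast h3.symm
      · intro γ hγ
        have h4 : x γ ≠ false := ht (hfin.mem_toFinset.mp hγ)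
        simpa using h4
  rw [h]
  refine isClosed_iInter fun F => IsOpen.isClosed_compl ?_
  have h5 : {x : Γ → Bool | ∀ γ ∈ F.1, x γ = true} =
      ⋂ γ ∈ F.1, (fun x : Γ → Bool => x γ) ⁻¹' {true} := by
    ext x
    simp
  rw [h5]
  exact isOpen_biInter_finset fun γ _ => (isOpen_discrete _).preimage (continuous_apply γ)

/-- `σ_n(Γ)` is compact, so that `C(·, ℝ)` of a product of such spaces, whose topology is the
compact-open one, is a Banach space under the supremum norm. -/
instance compactSpace_sigmaSpace (n : ℕ) (Γ : Type*) : CompactSpace (sigmaSpace n Γ) :=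
  isCompact_iff_compactSpace.mp (isClosed_sigmaSpace n Γ).isCompact

/-!
Write `A = σ_1(Γ)`, `K = A^ω` and `L = ∏ σ_{k_n}(Γ)`. The proof is a decomposition argument in the
manner of Pełczyński: `C(K)` absorbs `C(L)` and `C(L)` absorbs `C(K)`, so that
`C(L) ≅ C(K) × C(L) ≅ C(K)`. Absorption passes from a space to any space in which it is
complemented (`ComplementedIn.nonempty_equiv_prod`), and its source is the topology of `A`: adding
an isolated point to `A` does not change it (`nonempty_addPoint_homeomorph`), hence
`C(A × M) ≅ C(M) × C(A × M)` for every compact `M` (`prodCLEOfAddPoint`).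

* With `M = K`, this says that `C(K)` is isomorphic to its square. As the points of `σ_n(Γ)` whose
  support contains `n - 1` given elements form a clopen copy of `A`, `K` is a retract of `L`
  (`power_complementedIn`). So `C(L)` absorbs `C(K)`.
* With `M = L`, it says that `C(A × L)` absorbs `C(L)`, and it remains to see that `C(A × L)` is
  complemented in `C(K)`. Now `A × L` is again a product of spaces `σ_n(Γ)` with `n ≥ 1`, so it is
  enough that `C(∏ σ_{k_i}(Γ))` is complemented in `C(∏ A^{k_i})` (`complementedIn_pi_sigmaSpace`).
  Average a function on `∏ A^{k_i}` over the compact group `∏ Perm (Fin k_i)`, which acts by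
  permuting coordinates, and restrict the result to the closed set of those tuples whose entries
  have disjoint supports. There the union map onto `∏ σ_{k_i}(Γ)` has the orbits as its fibres, so
  the average descends to a continuous function on `∏ σ_{k_i}(Γ)`. This operator is a left inverse
  of the composition with the union map, and it has norm `1` however large the `k_i` are.
-/

open MeasureTheory

/-! ### Complemented subspaces and the decomposition method -/

/-- `E` is isomorphic to a complemented subspace of `F`: there are bounded operators `i : E → F`
and `p : F → E` with `p ∘ i = id`. -/
def ComplementedIn (E F : Type*) [NormedAddCommGroup E] [NormedSpace ℝ E]
    [NormedAddCommGroup F] [NormedSpace ℝ F] : Prop :=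
  ∃ (i : E →L[ℝ] F) (p : F →L[ℝ] E), ∀ x, p (i x) = x

namespace ComplementedIn

variable {E F G : Type*} [NormedAddCommGroup E] [NormedSpace ℝ E]
    [NormedAddCommGroup F] [NormedSpace ℝ F] [NormedAddCommGroup G] [NormedSpace ℝ G]

theorem trans_equiv (h : ComplementedIn E F) (e : F ≃L[ℝ] G) : ComplementedIn E G := by
  obtain ⟨i, p, hp⟩ := h
  exact ⟨e.toContinuousLinearMap.comp i, p.comp e.symm.toContinuousLinearMap,
    fun x => by simp [hp]⟩

theorem of_equiv (e : G ≃L[ℝ] E) (h : ComplementedIn E F) : ComplementedIn G F := by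
  obtain ⟨i, p, hp⟩ := h
  exact ⟨i.comp e.toContinuousLinearMap, e.symm.toContinuousLinearMap.comp p,
    fun x => by simp [hp]⟩

/-- If `E × G ≅ E` and `E` is complemented in `F`, then `F` also absorbs `G`: write
`F ≅ E × W` with `W` the kernel of the projection. -/
theorem nonempty_equiv_prod (h : ComplementedIn E F) (e : E ≃L[ℝ] G × E) :
    Nonempty (F ≃L[ℝ] G × F) := by
  obtain ⟨i, p, hp⟩ := h
  let d := ContinuousLinearEquiv.equivOfRightInverse p i hp
  exact ⟨d.trans ((e.prodCongr (.refl ℝ _)).trans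
    ((ContinuousLinearEquiv.prodAssoc ℝ G E _).trans
      ((ContinuousLinearEquiv.refl ℝ G).prodCongr d.symm)))⟩

end ComplementedIn

/-! ### Composition operators between spaces of continuous functions -/

section Composition

variable {X Y : Type*} [TopologicalSpace X] [CompactSpace X] [TopologicalSpace Y]
  [CompactSpace Y]

/-- Composition with a homeomorphism, as an isomorphism of Banach spaces. -/
def compHomeomorphCLE (e : X ≃ₜ Y) : C(X, ℝ) ≃L[ℝ] C(Y, ℝ) :=
  ContinuousLinearEquiv.equivOfInverse
    (ContinuousMap.compCLM ℝ ℝ (e.symm : C(Y, X))) (ContinuousMap.compCLM ℝ ℝ (e : C(X, Y)))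
    (fun f => by ext x; simp [ContinuousMap.compCLM])
    (fun f => by ext x; simp [ContinuousMap.compCLM])

/-- If `X` is a retract of `Y`, then `C(X)` is complemented in `C(Y)`. -/
theorem complementedIn_of_retract (i : C(X, Y)) (r : C(Y, X)) (h : ∀ x, r (i x) = x) :
    ComplementedIn C(X, ℝ) C(Y, ℝ) :=
  ⟨ContinuousMap.compCLM ℝ ℝ r, ContinuousMap.compCLM ℝ ℝ i, fun f => by
    ext x; simp [ContinuousMap.compCLM, h]⟩

/-- A function on a disjoint union is a pair of functions. -/
noncomputable def sumCLE : C(X ⊕ Y, ℝ) ≃L[ℝ] C(X, ℝ) × C(Y, ℝ) :=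
  LinearEquiv.toContinuousLinearEquivOfBounds
    { toFun f := (f.comp ⟨Sum.inl, continuous_inl⟩, f.comp ⟨Sum.inr, continuous_inr⟩)
      invFun p := ⟨Sum.elim p.1 p.2, p.1.continuous.sumElim p.2.continuous⟩
      map_add' _ _ := rfl
      map_smul' _ _ := rfl
      left_inv f := by ext (x | x) <;> rfl
      right_inv p := rfl }
    1 1
    (fun f => by
      rw [one_mul]
      exact max_le
        ((ContinuousMap.norm_le _ (norm_nonneg f)).2 fun x => f.norm_coe_le_norm (Sum.inl x))
        ((ContinuousMap.norm_le _ (norm_nonneg f)).2 fun x => f.norm_coe_le_norm (Sum.inr x)))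
    (fun p => by
      rw [one_mul]
      refine (ContinuousMap.norm_le _ (norm_nonneg p)).2 ?_
      rintro (x | x)
      · exact (p.1.norm_coe_le_norm x).trans (norm_fst_le p)
      · exact (p.2.norm_coe_le_norm x).trans (norm_snd_le p))

/-- If `X` is homeomorphic to `X` with an isolated point added, then `C(X × M) ≅ C(M) × C(X × M)`
for every compact space `M`. -/
noncomputable def prodCLEOfAddPoint (e : Unit ⊕ X ≃ₜ X) : C(X × Y, ℝ) ≃L[ℝ] C(Y, ℝ) × C(X × Y, ℝ) :=
  (compHomeomorphCLE (((e.symm.prodCongr (Homeomorph.refl Y)).trans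
    Homeomorph.sumProdDistrib).trans
      ((Homeomorph.punitProd Y).sumCongr (Homeomorph.refl (X × Y))))).trans sumCLE

end Composition

/-! ### Averaging over a compact group -/

/-- The invariant mean is integration against the normalized Haar measure. The group is not assumed
to be metrizable or Hausdorff, nor its Borel structure fixed, so only the functional is recorded. -/
theorem exists_invariant_mean (G : Type*) [Group G] [TopologicalSpace G] [IsTopologicalGroup G]
    [CompactSpace G] :
    ∃ m : C(G, ℝ) →L[ℝ] ℝ, m 1 = 1 ∧ (∀ f, |m f| ≤ ‖f‖) ∧
      ∀ (h : G) (f : C(G, ℝ)), m (f.comp ⟨fun g => h * g, continuous_const_mul h⟩) = m f := by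
  borelize G
  let μ : Measure G := Measure.haarMeasure ⊤
  have hμ : IsProbabilityMeasure μ := ⟨by
    simpa using Measure.haarMeasure_self (K₀ := (⊤ : TopologicalSpace.PositiveCompacts G))⟩
  have hint (f : C(G, ℝ)) : Integrable f μ :=
    f.continuous.integrable_of_hasCompactSupport (HasCompactSupport.of_compactSpace f)
  have hb (f : C(G, ℝ)) : |∫ g, f g ∂μ| ≤ ‖f‖ := by
    simpa using norm_integral_le_of_norm_le_const (μ := μ)
      (Filter.Eventually.of_forall fun g => f.norm_coe_le_norm g)
  refine ⟨LinearMap.mkContinuous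
    { toFun f := ∫ g, f g ∂μ
      map_add' f₁ f₂ := integral_add (hint f₁) (hint f₂)
      map_smul' c f := integral_const_mul c f } 1 (by simpa using hb), ?_, hb, ?_⟩
  · change ∫ _, (1 : ℝ) ∂μ = 1
    simp
  · intro h f
    exact integral_mul_left_eq_self (μ := μ) (fun g => f g) h

/-- Let a compact group `G` act continuously from the right on a compact space `X`, let
`u : X → Y` be `G`-invariant, and let `R ⊆ X` be closed with `u '' R = Y` such that points of `R`
with the same image lie in one orbit. Then `C(Y)` is complemented in `C(X)`: the function
`x ↦ ∫ f (x · g) dg` is constant on orbits, so that its restriction to `R` descends to a continuous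
function on `Y`, and this inverts `f ↦ f ∘ u`. -/
theorem complementedIn_of_orbits {X Y G : Type*} [TopologicalSpace X] [CompactSpace X]
    [TopologicalSpace Y] [CompactSpace Y] [T2Space Y]
    [Group G] [TopologicalSpace G] [IsTopologicalGroup G] [CompactSpace G]
    (act : C(X × G, X)) (hact : ∀ x h g, act (act (x, h), g) = act (x, h * g))
    (u : C(X, Y)) (hu : ∀ x g, u (act (x, g)) = u x)
    (R : Set X) (hR : IsClosed R) (hsurj : ∀ y, ∃ x ∈ R, u x = y)
    (horb : ∀ x ∈ R, ∀ y ∈ R, u x = u y → ∃ h, y = act (x, h)) :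
    ComplementedIn C(Y, ℝ) C(X, ℝ) := by
  obtain ⟨m, m_one, m_le, m_inv⟩ := exists_invariant_mean G
  let avg (f : C(X, ℝ)) : C(X, ℝ) := (m : C(C(G, ℝ), ℝ)).comp (f.comp act).curry
  have avg_apply (f x) : avg f x = m ((f.comp act).curry x) := rfl
  have avg_act (f x h) : avg f (act (x, h)) = avg f x := by
    rw [avg_apply, avg_apply, ← m_inv h ((f.comp act).curry x)]
    congr 1
    ext g
    simp [hact]
  have : CompactSpace R := isCompact_iff_compactSpace.mp hR.isCompact
  let q : C(R, Y) := u.comp ⟨Subtype.val, continuous_subtype_val⟩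
  have q_surj : Function.Surjective q := fun y => by
    obtain ⟨x, hx, rfl⟩ := hsurj y
    exact ⟨⟨x, hx⟩, rfl⟩
  have hq : Topology.IsQuotientMap q := .of_surjective_continuous q_surj q.continuous
  have descends (f) : Function.FactorsThrough
      ((avg f).comp ⟨Subtype.val, continuous_subtype_val⟩ : C(R, ℝ)) q := by
    intro x y hxy
    obtain ⟨h, hh⟩ := horb x x.2 y y.2 hxy
    simp [hh, avg_act]
  let T (f : C(X, ℝ)) : C(Y, ℝ) := hq.lift _ (descends f)
  have T_apply (f) (x : R) : T f (q x) = avg f x :=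
    DFunLike.congr_fun (hq.lift_comp _ (descends f)) x
  refine ⟨ContinuousMap.compCLM ℝ ℝ u, LinearMap.mkContinuous
    { toFun := T
      map_add' := fun f₁ f₂ => ?_
      map_smul' := fun c f => ?_ } 1 fun f => ?_, fun f => ?_⟩
  · ext y
    obtain ⟨x, rfl⟩ := q_surj y
    simp only [ContinuousMap.add_apply, T_apply, avg_apply]
    rw [← map_add]
    rfl
  · ext y
    obtain ⟨x, rfl⟩ := q_surj y
    simp only [ContinuousMap.smul_apply, T_apply, avg_apply, RingHom.id_apply]
    rw [← map_smul]
    rfl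
  · rw [one_mul]
    refine (ContinuousMap.norm_le _ (norm_nonneg f)).2 fun y => ?_
    obtain ⟨x, rfl⟩ := q_surj y
    change ‖T f (q x)‖ ≤ _
    rw [T_apply, avg_apply]
    exact (m_le _).trans ((ContinuousMap.norm_le _ (norm_nonneg f)).2 fun g =>
      f.norm_coe_le_norm _)
  · ext y
    obtain ⟨x, rfl⟩ := q_surj y
    change T (f.comp u) (q x) = _
    rw [T_apply, avg_apply]
    have : ((f.comp u).comp act).curry x.1 = f (q x) • (1 : C(G, ℝ)) := by
      ext g
      simp [hu, q]
    rw [this, map_smul, m_one, smul_eq_mul, mul_one]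

/-! ### The spaces `σ_n(Γ)` -/

section Sigma

variable {Γ Δ : Type*}

@[fun_prop]
theorem continuous_sigmaSpace_apply {n : ℕ} (γ : Γ) :
    Continuous fun x : sigmaSpace n Γ => x.1 γ :=
  (continuous_apply γ).comp continuous_subtype_val

theorem mem_sigmaSpace_one_iff {x : Γ → Bool} :
    x ∈ sigmaSpace 1 Γ ↔ ∀ a b, x a = true → x b = true → a = b := by
  simp [sigmaSpace, cubeSupport, Set.encard_le_one_iff]

/-- `σ_1(Γ)` is the disjoint union of the isolated point with support `{e none}` and of the copy of
`σ_1(Γ)` formed by the points that vanish at `e none`. -/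
theorem nonempty_addPoint_homeomorph (e : Option Γ ≃ Γ) :
    Nonempty (Unit ⊕ sigmaSpace 1 Γ ≃ₜ sigmaSpace 1 Γ) := by
  let pt : sigmaSpace 1 Γ := ⟨fun γ => (e.symm γ).isNone, by
    rw [mem_sigmaSpace_one_iff]
    intro a b ha hb
    simp only [Option.isNone_iff_eq_none] at ha hb
    exact e.symm.injective (ha.trans hb.symm)⟩
  let j (x : sigmaSpace 1 Γ) : sigmaSpace 1 Γ := ⟨fun γ => (e.symm γ).elim false x.1, by
    rw [mem_sigmaSpace_one_iff]
    intro a b ha hb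
    obtain ⟨a, rfl⟩ := e.surjective a
    obtain ⟨b, rfl⟩ := e.surjective b
    cases a <;> cases b <;> simp_all
    exact mem_sigmaSpace_one_iff.1 x.2 _ _ ha hb⟩
  have hj : Continuous j := by
    refine Continuous.subtype_mk (continuous_pi fun γ => ?_) _
    cases e.symm γ with
    | none => exact continuous_const
    | some a => exact continuous_sigmaSpace_apply a
  have hbij : Function.Bijective (Sum.elim (fun _ : Unit => pt) j) := by
    constructor
    · have hne (x) : pt ≠ j x := fun h => by
        have := congrFun (congrArg Subtype.val h) (e none)
        simp [pt, j] at this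
      rintro (_ | x) (_ | y) h
      · rfl
      · exact (hne y h).elim
      · exact (hne x h.symm).elim
      · congr 1
        ext γ
        have := congrFun (congrArg Subtype.val h) (e (some γ))
        simpa [j] using this
    · intro x
      by_cases hx : x.1 (e none) = true
      · refine ⟨Sum.inl (), Subtype.ext (funext fun γ => ?_)⟩
        obtain ⟨a, rfl⟩ := e.surjective γ
        cases a with
        | none => simp [pt, hx]
        | some a =>
          have : x.1 (e (some a)) ≠ true := fun h => by
            simpa using mem_sigmaSpace_one_iff.1 x.2 _ _ hx h
          simpa [pt] using this
      · refine ⟨Sum.inr ⟨fun γ => x.1 (e (some γ)), ?_⟩, Subtype.ext (funext fun γ => ?_)⟩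
        · rw [mem_sigmaSpace_one_iff]
          intro a b ha hb
          simpa using mem_sigmaSpace_one_iff.1 x.2 _ _ ha hb
        · obtain ⟨a, rfl⟩ := e.surjective γ
          cases a with
          | none => simpa [j] using hx
          | some a => simp [j]
  exact ⟨Continuous.homeoOfEquivCompactToT2 (f := Equiv.ofBijective _ hbij)
    (continuous_const.sumElim hj)⟩

/-- `σ_1(Γ)` is a retract of `σ_{m+1}(Γ)`: given `e : Fin m ⊕ Γ ≃ Γ`, the points of `σ_{m+1}(Γ)`
whose support contains the `m` elements `e (inl j)` form a clopen copy of `σ_1(Γ)`. -/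
theorem exists_retract_sigmaSpace {m : ℕ} (e : Fin m ⊕ Γ ≃ Γ) :
    ∃ (i : C(sigmaSpace 1 Γ, sigmaSpace (m + 1) Γ)) (r : C(sigmaSpace (m + 1) Γ, sigmaSpace 1 Γ)),
      ∀ x, r (i x) = x := by
  have supp_card (y : Γ → Bool) (hy : ∀ j, y (e (.inl j)) = true) :
      (cubeSupport y).encard = m + (cubeSupport fun γ => y (e (.inr γ))).encard := by
    have h : cubeSupport y = e '' (Set.range Sum.inl ∪
        Sum.inr '' cubeSupport fun γ => y (e (.inr γ))) := by
      ext γ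
      obtain ⟨a, rfl⟩ := e.surjective γ
      cases a <;> simp [cubeSupport, hy]
    rw [h, e.injective.encard_image, Set.encard_union_eq, Sum.inr_injective.encard_image,
      ← Set.image_univ, Sum.inl_injective.encard_image]
    · simp
    · rw [Set.disjoint_left]
      rintro _ ⟨a, rfl⟩ ⟨b, -, h⟩
      cases h
  refine ⟨⟨fun x => ⟨fun γ => Sum.elim (fun _ => true) x.1 (e.symm γ), ?_⟩, ?_⟩,
    ⟨fun y => ⟨fun γ => (decide (∀ j, y.1 (e (.inl j)) = true)) && y.1 (e (.inr γ)), ?_⟩, ?_⟩, ?_⟩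
  · have hx : (cubeSupport x.1).encard ≤ 1 := by simpa [sigmaSpace] using x.2
    change (cubeSupport _).encard ≤ _
    rw [supp_card _ (by simp)]
    simpa [add_comm] using add_le_add_left hx (m : ℕ∞)
  · refine Continuous.subtype_mk (continuous_pi fun γ => ?_) _
    cases e.symm γ with
    | inl _ => exact continuous_const
    | inr a => exact continuous_sigmaSpace_apply a
  · by_cases hy : ∀ j, y.1 (e (.inl j)) = true
    · have h := y.2
      change (cubeSupport _).encard ≤ _ at h
      rw [supp_card _ hy] at h
      change (cubeSupport _).encard ≤ _
      simp only [hy, implies_true, decide_true, Bool.true_and]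
      push_cast at h ⊢
      exact (ENat.add_le_add_iff_left (ENat.natCast_ne_top m)).1 h
    · simp [hy, sigmaSpace, cubeSupport]
  · refine Continuous.subtype_mk (continuous_pi fun γ => ?_) _
    have h : Continuous fun p : (Fin m → Bool) × Bool => (decide (∀ j, p.1 j = true)) && p.2 :=
      continuous_of_discreteTopology
    exact h.comp (f := fun y : sigmaSpace (m + 1) Γ =>
      ((fun j => y.1 (e (.inl j))), y.1 (e (.inr γ)))) (by fun_prop)
  · intro x
    ext γ
    simp

/-- The union of `n` points of `σ_1(Γ)`, as a point of `σ_n(Γ)`. -/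
def unionMap (n : ℕ) (Γ : Type*) : C(Fin n → sigmaSpace 1 Γ, sigmaSpace n Γ) where
  toFun y := ⟨fun γ => decide (∃ i, (y i).1 γ = true), by
    have h : cubeSupport (fun γ => decide (∃ i, (y i).1 γ = true)) =
        ⋃ i, cubeSupport (y i).1 := by
      ext γ
      simp [cubeSupport]
    change (cubeSupport _).encard ≤ _
    rw [h]
    refine (Set.encard_iUnion_le_of_fintype _).trans ((Finset.sum_le_card_nsmul _ _ 1 ?_).trans ?_)
    · intro i _
      simpa [sigmaSpace] using (y i).2
    · simp⟩
  continuous_toFun := by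
    refine Continuous.subtype_mk (continuous_pi fun γ => ?_) _
    have h : Continuous fun p : Fin n → Bool => decide (∃ i, p i = true) :=
      continuous_of_discreteTopology
    exact h.comp (f := fun (y : Fin n → sigmaSpace 1 Γ) i => (y i).1 γ)
      (continuous_pi fun i => (continuous_sigmaSpace_apply γ).comp (continuous_apply i))

theorem unionMap_apply {n : ℕ} (y : Fin n → sigmaSpace 1 Γ) (γ : Γ) :
    (unionMap n Γ y).1 γ = true ↔ ∃ i, (y i).1 γ = true := by
  simp [unionMap]

theorem unionMap_comp_perm {n : ℕ} (y : Fin n → sigmaSpace 1 Γ) (g : Equiv.Perm (Fin n)) :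
    unionMap n Γ (fun i => y (g i)) = unionMap n Γ y := by
  ext γ
  rw [Bool.eq_iff_iff, unionMap_apply, unionMap_apply]
  exact (g.surjective.exists (p := fun i => (y i).1 γ = true)).symm

/-- The tuples of points of `σ_1(Γ)` with pairwise disjoint supports. -/
def disjointTuples (n : ℕ) (Γ : Type*) : Set (Fin n → sigmaSpace 1 Γ) :=
  {y | ∀ i j γ, (y i).1 γ = true → (y j).1 γ = true → i = j}

theorem isClosed_disjointTuples (n : ℕ) (Γ : Type*) : IsClosed (disjointTuples n Γ) := by
  simp only [disjointTuples, Set.ofPred_forall]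
  refine isClosed_iInter fun i => isClosed_iInter fun j => isClosed_iInter fun γ => ?_
  exact (isClosed_discrete {p : Bool × Bool | p.1 = true → p.2 = true → i = j}).preimage
    (f := fun y : Fin n → sigmaSpace 1 Γ => ((y i).1 γ, (y j).1 γ))
    (((continuous_sigmaSpace_apply γ).comp (continuous_apply i)).prodMk
      ((continuous_sigmaSpace_apply γ).comp (continuous_apply j)))

/-- Every point of `σ_n(Γ)` is the union of a disjoint tuple, namely of an enumeration of its
support, filled up with empty sets. -/
theorem exists_disjointTuples (n : ℕ) (x : sigmaSpace n Γ) :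
    ∃ y ∈ disjointTuples n Γ, unionMap n Γ y = x := by
  classical
  have hfin : (cubeSupport x.1).Finite :=
    Set.encard_ne_top_iff.1 (ne_top_of_le_ne_top (ENat.natCast_ne_top n) x.2)
  have : Fintype (cubeSupport x.1) := hfin.fintype
  have hcard : Fintype.card (cubeSupport x.1) ≤ Fintype.card (Fin n) := by
    have h : (cubeSupport x.1).encard ≤ n := x.2
    rw [Set.encard_eq_coe_toFinset_card, Set.toFinset_card] at h
    rw [Fintype.card_fin]
    exact_mod_cast h
  obtain ⟨φ⟩ := Function.Embedding.nonempty_of_card_le hcard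
  let y (i : Fin n) : sigmaSpace 1 Γ :=
    ⟨fun γ => decide (∃ h : γ ∈ cubeSupport x.1, φ ⟨γ, h⟩ = i), by
      rw [mem_sigmaSpace_one_iff]
      intro a b ha hb
      simp only [decide_eq_true_eq] at ha hb
      obtain ⟨ha, h⟩ := ha
      obtain ⟨hb, h'⟩ := hb
      simpa using φ.injective (h.trans h'.symm)⟩
  refine ⟨y, ?_, ?_⟩
  · intro i j γ hi hj
    simp only [y, decide_eq_true_eq] at hi hj
    obtain ⟨_, rfl⟩ := hi
    obtain ⟨_, rfl⟩ := hj
    rfl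
  · ext γ
    rw [Bool.eq_iff_iff, unionMap_apply]
    simp [y, cubeSupport]

/-- Disjoint tuples with the same union differ by a permutation: match the nonempty entries with
the same support, and extend to the empty ones. -/
theorem exists_perm_of_unionMap_eq {n : ℕ} {y z : Fin n → sigmaSpace 1 Γ}
    (hy : y ∈ disjointTuples n Γ) (hz : z ∈ disjointTuples n Γ)
    (h : unionMap n Γ y = unionMap n Γ z) :
    ∃ g : Equiv.Perm (Fin n), z = fun i => y (g i) := by
  have key {y z : Fin n → sigmaSpace 1 Γ} (h : unionMap n Γ y = unionMap n Γ z) {i : Fin n} {γ : Γ}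
      (hi : (y i).1 γ = true) : ∃ j, (z j).1 γ = true := by
    rw [← unionMap_apply, ← h, unionMap_apply]
    exact ⟨i, hi⟩
  have key' {y z : Fin n → sigmaSpace 1 Γ} (h : unionMap n Γ y = unionMap n Γ z)
      (i : {i // ∃ γ, (y i).1 γ = true}) :
      ∃ j : {j // ∃ γ, (z j).1 γ = true}, ∃ γ, (y i).1 γ = true ∧ (z j).1 γ = true := by
    obtain ⟨i, γ, hi⟩ := i
    obtain ⟨j, hj⟩ := key h hi
    exact ⟨⟨j, γ, hj⟩, γ, hi, hj⟩
  have uniq (x : sigmaSpace 1 Γ) {a b} (ha : x.1 a = true) (hb : x.1 b = true) : a = b :=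
    mem_sigmaSpace_one_iff.1 x.2 a b ha hb
  choose p hp using key' h.symm
  choose q hq using key' h
  let e : {i // ∃ γ, (z i).1 γ = true} ≃ {i // ∃ γ, (y i).1 γ = true} :=
    { toFun := p
      invFun := q
      left_inv i := by
        obtain ⟨a, ha, ha'⟩ := hp i
        obtain ⟨b, hb, hb'⟩ := hq (p i)
        cases uniq _ ha' hb
        exact Subtype.ext (hz _ _ a hb' ha)
      right_inv i := by
        obtain ⟨a, ha, ha'⟩ := hq i
        obtain ⟨b, hb, hb'⟩ := hp (q i)
        cases uniq _ ha' hb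
        exact Subtype.ext (hy _ _ a hb' ha) }
  classical
  refine ⟨e.extendSubtype, funext fun i => Subtype.ext (funext fun γ => ?_)⟩
  by_cases hi : ∃ γ, (z i).1 γ = true
  · rw [e.extendSubtype_apply_of_mem i hi]
    obtain ⟨a, ha, ha'⟩ := hp ⟨i, hi⟩
    rw [Bool.eq_iff_iff]
    constructor
    · intro hγ
      cases uniq _ ha hγ
      exact ha'
    · intro hγ
      cases uniq _ ha' hγ
      exact ha
  · have h1 : ¬ (z i).1 γ = true := fun h => hi ⟨γ, h⟩
    have h2 : ¬ (y (e.extendSubtype i)).1 γ = true := fun h =>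
      e.extendSubtype_not_mem i hi ⟨γ, h⟩
    rw [Bool.not_eq_true] at h1 h2
    rw [h1, h2]

/-- `C(∏ σ_{k_i}(Γ))` is complemented in `C(∏ σ_1(Γ)^{k_i})`: average over the group
`∏ Perm (Fin (k i))`, which permutes coordinates. The disjoint tuples `y` play the role of the
closed set `R` of `complementedIn_of_orbits`; all tuples will not do, as `(a, a)` and `(a, 0)` have
the same union and lie in different orbits. -/
theorem complementedIn_pi_sigmaSpace {ι : Type*} (k : ι → ℕ) (Γ : Type*) :
    ComplementedIn C((i : ι) → sigmaSpace (k i) Γ, ℝ)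
      C((i : ι) → Fin (k i) → sigmaSpace 1 Γ, ℝ) := by
  let (i : ι) : TopologicalSpace (Equiv.Perm (Fin (k i))) := ⊥
  have (i : ι) : DiscreteTopology (Equiv.Perm (Fin (k i))) := ⟨rfl⟩
  have act_cont : Continuous fun (p : ((i : ι) → Fin (k i) → sigmaSpace 1 Γ) ×
      ((i : ι) → Equiv.Perm (Fin (k i)))) (i : ι) (j : Fin (k i)) => p.1 i (p.2 i j) := by
    refine continuous_pi fun i => continuous_pi fun j => ?_
    have h : Continuous fun p : (Fin (k i) → sigmaSpace 1 Γ) × Equiv.Perm (Fin (k i)) =>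
        p.1 (p.2 j) := continuous_prod_of_discrete_right.2 fun g => continuous_apply (g j)
    exact h.comp (f := fun p : ((i : ι) → Fin (k i) → sigmaSpace 1 Γ) ×
      ((i : ι) → Equiv.Perm (Fin (k i))) => (p.1 i, p.2 i)) (by fun_prop)
  refine complementedIn_of_orbits ⟨_, act_cont⟩ (fun _ _ _ => rfl)
    ⟨fun y i => unionMap (k i) Γ (y i), by fun_prop⟩
    (fun y g => funext fun i => unionMap_comp_perm (y i) (g i))
    (Set.univ.pi fun i => disjointTuples (k i) Γ)
    (isClosed_set_pi fun i _ => isClosed_disjointTuples (k i) Γ) (fun x => ?_)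
    (fun y hy z hz h => ?_)
  · choose y hy hyx using fun i => exists_disjointTuples (k i) (x i)
    exact ⟨y, fun i _ => hy i, funext hyx⟩
  · choose g hg using fun i => exists_perm_of_unionMap_eq (hy i trivial) (hz i trivial)
      (congrFun h i)
    exact ⟨g, funext hg⟩

end Sigma

/-! ### The isomorphism -/

section Main

variable {Γ : Type*}

/-- All countably infinite powers of a space are homeomorphic. -/
theorem nonempty_homeomorph_pi {ι : Type*} [Countable ι] [Infinite ι] (X : Type*)
    [TopologicalSpace X] : Nonempty ((ι → X) ≃ₜ (ℕ → X)) := by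
  obtain ⟨e⟩ := nonempty_equiv_of_countable (α := ι) (β := ℕ)
  exact ⟨Homeomorph.piCongrLeft (Y := fun _ => X) e⟩

/-- A product indexed by `Option ι` splits off the factor at `none`. -/
def piOptionHomeomorph {ι : Type*} (X : Option ι → Type*) [∀ o, TopologicalSpace (X o)] :
    ((o : Option ι) → X o) ≃ₜ X none × ((i : ι) → X (some i)) where
  toEquiv := Equiv.piOptionEquivProd
  continuous_toFun := by
    change Continuous fun f : (o : Option ι) → X o => (f none, fun i : ι => f (some i))
    fun_prop
  continuous_invFun := by
    refine continuous_pi fun o => ?_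
    cases o with
    | none => exact continuous_fst
    | some i => exact (continuous_apply i).comp continuous_snd

/-- A product over a sigma type is an iterated product. -/
def piSigmaHomeomorph {ι : Type*} (κ : ι → Type*) (X : Type*) [TopologicalSpace X] :
    ((Σ i, κ i) → X) ≃ₜ ((i : ι) → κ i → X) where
  toEquiv := Equiv.piCurry fun _ _ => X
  continuous_toFun := continuous_pi fun i => continuous_pi fun j =>
    continuous_apply (⟨i, j⟩ : Σ i, κ i)
  continuous_invFun := continuous_pi fun p => (continuous_apply p.2).comp (continuous_apply p.1)

/-- For positive `k`, the product of the `σ_1(Γ)^{k_i}` is a countably infinite power of `σ_1(Γ)`,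
so the averaging projection lives on `C(σ_1(Γ)^ω)`. -/
theorem complementedIn_power {ι : Type*} [Countable ι] [Infinite ι] (k : ι → ℕ)
    (hk : ∀ i, 0 < k i) :
    ComplementedIn C((i : ι) → sigmaSpace (k i) Γ, ℝ) C(ℕ → sigmaSpace 1 Γ, ℝ) := by
  have : Infinite (Σ i, Fin (k i)) :=
    Infinite.of_injective (fun i => ⟨i, ⟨0, hk i⟩⟩) fun i j h => congrArg Sigma.fst h
  obtain ⟨e⟩ := nonempty_homeomorph_pi (ι := Σ i, Fin (k i)) (sigmaSpace 1 Γ)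
  exact (complementedIn_pi_sigmaSpace k Γ).trans_equiv
    (compHomeomorphCLE ((piSigmaHomeomorph (fun i => Fin (k i)) (sigmaSpace 1 Γ)).symm.trans e))

/-- `σ_1(Γ)^ω` is a retract of `∏ σ_{k_n}(Γ)`, coordinatewise. -/
theorem power_complementedIn [Infinite Γ] (k : ℕ → ℕ) (hk : ∀ n, 0 < k n) :
    ComplementedIn C(ℕ → sigmaSpace 1 Γ, ℝ) C((n : ℕ) → sigmaSpace (k n) Γ, ℝ) := by
  have retr (n) : ∃ (i : C(sigmaSpace 1 Γ, sigmaSpace (k n) Γ))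
      (r : C(sigmaSpace (k n) Γ, sigmaSpace 1 Γ)), ∀ x, r (i x) = x := by
    obtain ⟨m, hm⟩ := Nat.exists_eq_succ_of_ne_zero (hk n).ne'
    have e : Nonempty (Fin m ⊕ Γ ≃ Γ) := by
      rw [← Cardinal.eq]
      simpa using Cardinal.nat_add_eq m (Cardinal.aleph0_le_mk Γ)
    obtain ⟨e⟩ := e
    rw [hm]
    exact exists_retract_sigmaSpace e
  choose i r hir using retr
  exact complementedIn_of_retract ⟨fun x n => i n (x n), by fun_prop⟩
    ⟨fun y n => r n (y n), by fun_prop⟩ fun x => funext fun n => hir n (x n)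

end Main

theorem theorem2 (Γ : Type*) [Infinite Γ] (k : ℕ → ℕ) (hk : ∀ n, 0 < k n) :
    Nonempty (C((n : ℕ) → sigmaSpace (k n) Γ, ℝ) ≃L[ℝ] C(ℕ → sigmaSpace 1 Γ, ℝ)) := by
  obtain ⟨e⟩ := nonempty_addPoint_homeomorph (Γ := Γ) (by
    have : Nonempty (Option Γ ≃ Γ) := by
      rw [← Cardinal.eq]
      simp
    exact this.some)
  obtain ⟨d⟩ := nonempty_homeomorph_pi (ι := Option ℕ) (sigmaSpace 1 Γ)
  -- `X := C(σ_1(Γ)^ω)` is isomorphic to its square, since `σ_1(Γ)^ω ≅ σ_1(Γ) × σ_1(Γ)^ω`.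
  let s : C(sigmaSpace 1 Γ × (ℕ → sigmaSpace 1 Γ), ℝ) ≃L[ℝ] C(ℕ → sigmaSpace 1 Γ, ℝ) :=
    compHomeomorphCLE ((piOptionHomeomorph fun _ => sigmaSpace 1 Γ).symm.trans d)
  let square := s.symm.trans ((prodCLEOfAddPoint e).trans
    ((ContinuousLinearEquiv.refl ℝ _).prodCongr s))
  -- So `Y := C(∏ σ_{k_n}(Γ))`, which contains `X` complementably, absorbs `X`.
  obtain ⟨e₁⟩ := (power_complementedIn (Γ := Γ) k hk).nonempty_equiv_prod square
  -- `C(σ_1(Γ) × ∏ σ_{k_n}(Γ))` absorbs `Y` and is complemented in `X`, as it belongs to the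
  -- sequence `1, k_0, k_1, …`. So `X` absorbs `Y`.
  let k' (o : Option ℕ) : ℕ := o.elim 1 k
  have hk' (o) : 0 < k' o := by
    cases o with
    | none => exact one_pos
    | some n => exact hk n
  obtain ⟨e₂⟩ := ((complementedIn_power (Γ := Γ) k' hk').of_equiv (compHomeomorphCLE
    (piOptionHomeomorph fun o => sigmaSpace (k' o) Γ).symm)).nonempty_equiv_prod
      (prodCLEOfAddPoint (Y := (n : ℕ) → sigmaSpace (k n) Γ) e)
  exact ⟨e₁.trans ((ContinuousLinearEquiv.prodComm ℝ _ _).trans e₂.symm)⟩
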